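/- Let $n\ge 0$, $k\ge 1$ and $d\ge 2$ be integers with $(d,k)\ne(2,1)$. A polygonal curve with $k$ vertices in $\mathbb{R}^d$ is a sequence of $k$ points of $\mathbb{R}^d$. For $P=(p_1,\dots,p_k)$ and $Q=(q_1,\dots,q_k)$, a coupling is a sequence of index pairs that starts with $(1,1)$, ends with $(k,k)$, and in each step increases the first index, the second index, or both, by one; the discrete Fréchet distance of $P$ and $Q$ is the minimum over all couplings of the maximum of $\|p_i-q_j\|$ (Euclidean norm) over the pairs $(i,j)$ in the coupling. For a finite set $S$ of curves with $k$ vertices in $\mathbb{R}^d$, a Voronoi region of $S$ is a nonempty class of all curves with $k$ vertices in $\mathbb{R}^d$ having one and the same set of nearest neighbours in $S$ under the discrete Fréchet distance. Then there is a set $S$ of $n$ distinct polygonal curves in $\mathbb{R}^d$ with $k$ vertices each that has at least $$\left\lfloor \frac{n}{d(k-1)+2}\right\rfloor^{d(k-1)+2}$$ Voronoi regions. -/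

import Mathlib

namespace FrechetVoronoi

/-- A polygonal curve with `k` vertices in `ℝ^d`, given by its sequence of vertices
(equivalently, a point of `ℝ^(d * k)`). -/
abbrev Curve (d k : ℕ) : Type := Fin k → EuclideanSpace ℝ (Fin d)

/-- A coupling of a `k`-vertex sequence with an `l`-vertex sequence: a sequence of index pairs
from (first, first) to (last, last), each step of which advances the first index by one, or the
second index by one, or both. -/
structure Coupling (k l : ℕ) where
  /-- the number of steps -/
  steps : ℕ
  /-- the index in the first sequence -/
  left : Fin (steps + 1) → Fin k
  /-- the index in the second sequence -/
  right : Fin (steps + 1) → Fin l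
  left_first : (left 0 : ℕ) = 0
  right_first : (right 0 : ℕ) = 0
  left_last : (left (Fin.last steps) : ℕ) + 1 = k
  right_last : (right (Fin.last steps) : ℕ) + 1 = l
  step : ∀ i : Fin steps,
    ((left i.succ : ℕ) = left i.castSucc + 1 ∧ (right i.succ : ℕ) = right i.castSucc) ∨
    ((left i.succ : ℕ) = left i.castSucc ∧ (right i.succ : ℕ) = right i.castSucc + 1) ∨
    ((left i.succ : ℕ) = left i.castSucc + 1 ∧ (right i.succ : ℕ) = right i.castSucc + 1)

/-- The largest Euclidean distance between two vertices that are paired by the coupling. -/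
noncomputable def Coupling.cost {d k l : ℕ} (C : Coupling k l) (P : Curve d k) (Q : Curve d l) :
    ℝ :=
  ⨆ i : Fin (C.steps + 1), dist (P (C.left i)) (Q (C.right i))

/-- The discrete Fréchet distance: the least cost of a coupling. -/
noncomputable def discreteFrechet {d k l : ℕ} (P : Curve d k) (Q : Curve d l) : ℝ :=
  ⨅ C : Coupling k l, C.cost P Q

/-- The set of nearest neighbours of `Q` in `S` under the discrete Fréchet distance. -/
def nearestNeighbors {d k : ℕ} (S : Finset (Curve d k)) (Q : Curve d k) : Set (Curve d k) :=
  {P | P ∈ S ∧ ∀ P' ∈ S, discreteFrechet P Q ≤ discreteFrechet P' Q}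

/-- The Voronoi regions of `S`: the (nonempty) classes of all curves with `k` vertices that have
the same set of nearest neighbours in `S`. -/
def voronoiRegions {d k : ℕ} (S : Finset (Curve d k)) : Set (Set (Curve d k)) :=
  {R | ∃ Q : Curve d k, R = {Q' | nearestNeighbors S Q' = nearestNeighbors S Q}}

end FrechetVoronoi

/-! For `k ≥ 2` every site displaces one vertex of a base curve whose vertices are far apart
compared with all displacements, so distances up to the relevant radius are read off along the
diagonal coupling (`discreteFrechet_le_iff`). The first vertex of a query lies at distance exactly
`r` from the undisplaced first vertex and from one chosen point of a circle, and farther from the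
other circle points. Hence `r` is the minimal distance, attained by the chosen circle site and by
those chain sites whose displaced vertex lies in the ball of radius `r` about the query's vertex.

At large scale this ball cuts a chain like a half-space (`norm_smul_sub_le_iff`). The `d(k-1)`
coordinates of the later query vertices and the radius are `d(k-1)+1` free parameters, one per
chain, so the cuts are independent: `A` circle sites and chains of length `m` yield `A * m ^
(d(k-1)+1)` sets of nearest neighbours. For `k = 1`, `d ≥ 3`, two skew lines suffice. -/

namespace FrechetVoronoi

open scoped RealInnerProductSpace

/-! ### Couplings and the discrete Fréchet distance -/

/-- The coupling that pairs equal indices. -/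
def Coupling.diagonal (k : ℕ) : Coupling (k + 1) (k + 1) where
  steps := k
  left := id
  right := id
  left_first := rfl
  right_first := rfl
  left_last := by simp
  right_last := by simp
  step i := by simp

theorem Coupling.dist_le_cost {d k l : ℕ} (C : Coupling k l) (P : Curve d k) (Q : Curve d l)
    (t : Fin (C.steps + 1)) : dist (P (C.left t)) (Q (C.right t)) ≤ C.cost P Q :=
  le_ciSup (f := fun i => dist (P (C.left i)) (Q (C.right i))) (Set.finite_range _).bddAbove t

theorem Coupling.cost_nonneg {d k l : ℕ} (C : Coupling k l) (P : Curve d k) (Q : Curve d l) :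
    0 ≤ C.cost P Q :=
  dist_nonneg.trans (C.dist_le_cost P Q 0)

/-- The left index runs from first to last in increments of at most one, so it skips nothing. -/
theorem Coupling.exists_left_eq {k l : ℕ} (C : Coupling k l) (i : Fin k) :
    ∃ t, C.left t = i := by
  have key : ∀ t : Fin (C.steps + 1), ∀ v ≤ (C.left t : ℕ), ∃ s, (C.left s : ℕ) = v := by
    intro t
    induction t using Fin.induction with
    | zero =>
      intro v hv
      exact ⟨0, by have := C.left_first; omega⟩
    | succ t ih =>
      intro v hv
      by_cases h : v ≤ (C.left t.castSucc : ℕ)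
      · exact ih v h
      · exact ⟨t.succ, by have := C.step t; omega⟩
  obtain ⟨s, hs⟩ := key (Fin.last _) i (by have := C.left_last; omega)
  exact ⟨s, Fin.ext hs⟩

theorem discreteFrechet_le_cost {d k l : ℕ} (P : Curve d k) (Q : Curve d l) (C : Coupling k l) :
    discreteFrechet P Q ≤ C.cost P Q :=
  ciInf_le ⟨0, by rintro _ ⟨C, rfl⟩; exact C.cost_nonneg P Q⟩ C

/-- Every coupling starts with the pair of first vertices. This is what makes `r` a lower bound for
all sites. -/
theorem dist_zero_le_discreteFrechet {d k : ℕ} (P Q : Curve d (k + 1)) :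
    dist (P 0) (Q 0) ≤ discreteFrechet P Q := by
  have : Nonempty (Coupling (k + 1) (k + 1)) := ⟨Coupling.diagonal k⟩
  refine le_ciInf fun C => ?_
  have h := C.dist_le_cost P Q 0
  rwa [show C.left 0 = 0 from Fin.ext C.left_first,
    show C.right 0 = 0 from Fin.ext C.right_first] at h

/-- If distinct positions are more than `r` apart, only the diagonal coupling can cost at most
`r`. -/
theorem discreteFrechet_le_iff {d k : ℕ} {P Q : Curve d (k + 1)} {r R : ℝ} (hr : r < R)
    (hsep : ∀ i j, i ≠ j → R ≤ dist (P i) (Q j)) :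
    discreteFrechet P Q ≤ r ↔ ∀ i, dist (P i) (Q i) ≤ r := by
  constructor
  · intro h i
    have : Nonempty (Coupling (k + 1) (k + 1)) := ⟨Coupling.diagonal k⟩
    -- Where a coupling visits `i`, it either pairs `i` with itself or pays at least `R`.
    have hmin : min R (dist (P i) (Q i)) ≤ discreteFrechet P Q := by
      refine le_ciInf fun C => ?_
      obtain ⟨t, rfl⟩ := C.exists_left_eq i
      have ht := C.dist_le_cost P Q t
      by_cases heq : C.left t = C.right t
      · rw [← heq] at ht
        exact (min_le_right _ _).trans ht
      · exact (min_le_left _ _).trans ((hsep _ _ heq).trans ht)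
    rcases min_le_iff.1 (hmin.trans h) with h | h
    · linarith
    · exact h
  · intro h
    exact (discreteFrechet_le_cost P Q (Coupling.diagonal k)).trans (ciSup_le fun i => h i)

/-! ### Counting regions through sets of nearest neighbours -/

/-- A family of queries whose sets of nearest neighbours are pairwise distinct gives a lower bound
for the number of Voronoi regions. -/
theorem card_le_encard_voronoiRegions {d k : ℕ} {ι κ : Type*} [Fintype ι] [Fintype κ]
    (P : ι ↪ Curve d k) (Q : κ → Curve d k) (r : κ → ℝ) (N : κ → Set ι)
    (hN : Function.Injective N) (hne : ∀ q, (N q).Nonempty)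
    (hle : ∀ q x, r q ≤ discreteFrechet (P x) (Q q))
    (hmem : ∀ q x, discreteFrechet (P x) (Q q) ≤ r q ↔ x ∈ N q) :
    (Fintype.card κ : ℕ∞) ≤ (voronoiRegions (Finset.univ.map P)).encard := by
  have hNN : ∀ q x, P x ∈ nearestNeighbors (Finset.univ.map P) (Q q) ↔ x ∈ N q := by
    intro q x
    simp only [nearestNeighbors, Finset.mem_map, Finset.mem_univ, true_and, Set.mem_ofPred_eq,
      forall_exists_index, forall_apply_eq_imp_iff, exists_apply_eq_apply]
    constructor
    · intro h
      obtain ⟨y, hy⟩ := hne q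
      exact (hmem q x).1 ((h y).trans ((hmem q y).2 hy))
    · intro h y
      exact ((hmem q x).2 h).trans (hle q y)
  let F : κ → Set (Curve d k) := fun q =>
    {Q' | nearestNeighbors (Finset.univ.map P) Q' = nearestNeighbors (Finset.univ.map P) (Q q)}
  have hF : Function.Injective F := by
    intro q q' h
    have h1 : Q q ∈ F q' := h ▸ (rfl : Q q ∈ F q)
    have h2 : nearestNeighbors (Finset.univ.map P) (Q q)
      = nearestNeighbors (Finset.univ.map P) (Q q') := h1
    apply hN
    ext x
    rw [← hNN, ← hNN, h2]
  calc (Fintype.card κ : ℕ∞) = ENat.card κ := by simp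
    _ = (Set.range F).encard := by rw [← Set.image_univ, hF.encard_image, Set.encard_univ]
    _ ≤ _ := Set.encard_le_encard (by rintro _ ⟨q, rfl⟩; exact ⟨Q q, rfl⟩)

/-! ### Euclidean geometry of balls and circles -/

/-- The cut of a chain of points in direction `b` by a large ball with centre `y`. -/
theorem norm_smul_sub_le_iff {E : Type*} [NormedAddCommGroup E] [InnerProductSpace ℝ E]
    {b y : E} (hb : ‖b‖ = 1) {L δ u t m : ℝ} (hL : m ^ 2 + ‖y‖ ^ 2 ≤ L) (hδ : 0 ≤ δ)
    (hin : ⟪b, y⟫ = u - δ) (hm : u - t ≤ m) (hgap : t < u → 1 / 2 ≤ u - t) (hne : t ≠ u) :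
    ‖(L + t) • b - y‖ ≤ L + δ ↔ t < u := by
  have hL0 : 0 ≤ L := le_trans (by positivity) hL
  constructor
  · intro h
    -- Beyond the threshold the component along `b` alone exceeds the radius.
    by_contra! hc
    have hlt := lt_of_le_of_ne hc hne.symm
    have h1 : ⟪b, (L + t) • b - y⟫ ≤ ‖b‖ * ‖(L + t) • b - y‖ := real_inner_le_norm _ _
    rw [inner_sub_right, inner_smul_right, real_inner_self_eq_norm_sq, hb, hin] at h1
    linarith
  · intro h
    have hg := hgap h
    refine (sq_le_sq₀ (norm_nonneg _) (by linarith)).1 ?_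
    rw [norm_sub_sq_real, norm_smul, real_inner_smul_left, hin, hb, mul_one, Real.norm_eq_abs,
      sq_abs]
    have h1 : (u - t) ^ 2 ≤ m ^ 2 := by gcongr
    -- The difference of squares is `2(u-t)(L+δ) + (u-δ)² - (u-t)² - ‖y‖²`; the gap `1/2` makes the
    -- first term at least `L`, which pays for the negative ones.
    nlinarith [sq_nonneg (u - δ), mul_nonneg (sub_nonneg.2 hg) hL0, mul_nonneg (sub_nonneg.2 hg) hδ]

theorem injective_rational_circle {a b : ℕ}
    (h : (1 - (a : ℝ) ^ 2) / (1 + a ^ 2) = (1 - (b : ℝ) ^ 2) / (1 + b ^ 2)) : a = b := by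
  rw [div_eq_div_iff (by positivity) (by positivity)] at h
  have : (a : ℝ) ^ 2 = b ^ 2 := by linarith
  have := (sq_eq_sq₀ (by positivity) (by positivity)).1 this
  exact_mod_cast this

/-- Rational points of the unit circle, told apart by their first coordinate; `v a` is `w a` after a
quarter turn. -/
theorem exists_unit_vectors {d : ℕ} (hd : 2 ≤ d) :
    ∃ w v : ℕ → EuclideanSpace ℝ (Fin d), (∀ a, ‖w a‖ = 1) ∧ (∀ a, ‖v a‖ = 1) ∧
      (∀ a, ⟪w a, v a⟫ = 0) ∧ ∀ a b, a ≠ b → ⟪w a, w b⟫ < 1 := by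
  set e0 : EuclideanSpace ℝ (Fin d) := EuclideanSpace.single ⟨0, by omega⟩ 1
  set e1 : EuclideanSpace ℝ (Fin d) := EuclideanSpace.single ⟨1, by omega⟩ 1
  have h00 : ⟪e0, e0⟫ = 1 := by simp [e0]
  have h11 : ⟪e1, e1⟫ = 1 := by simp [e1]
  have h01 : ⟪e0, e1⟫ = 0 := by simp [e0, e1, EuclideanSpace.inner_single_left]
  have h10 : ⟪e1, e0⟫ = 0 := by simp [e0, e1, EuclideanSpace.inner_single_left]
  let c : ℕ → ℝ := fun a => (1 - (a : ℝ) ^ 2) / (1 + a ^ 2)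
  let s : ℕ → ℝ := fun a => (2 * (a : ℝ)) / (1 + a ^ 2)
  have hcs : ∀ a, c a ^ 2 + s a ^ 2 = 1 := by
    intro a
    have : (1 + (a : ℝ) ^ 2) ≠ 0 := by positivity
    simp only [c, s]
    field_simp
    ring
  have hin : ∀ p q p' q' : ℝ, ⟪p • e0 + q • e1, p' • e0 + q' • e1⟫ = p * p' + q * q' := by
    intro p q p' q'
    simp only [inner_add_left, inner_add_right, real_inner_smul_left, real_inner_smul_right,
      h00, h01, h10, h11]
    ring
  have hnorm : ∀ p q : ℝ, p ^ 2 + q ^ 2 = 1 → ‖p • e0 + q • e1‖ = 1 := by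
    intro p q h
    rw [← sq_eq_sq₀ (norm_nonneg _) zero_le_one, ← real_inner_self_eq_norm_sq, hin]
    linarith
  have hw : ∀ a, ‖c a • e0 + s a • e1‖ = 1 := fun a => hnorm _ _ (hcs a)
  refine ⟨fun a => c a • e0 + s a • e1, fun a => (-s a) • e0 + c a • e1, hw,
    fun a => hnorm _ _ (by linarith [hcs a, neg_sq (s a)]), fun a => ?_, fun a b hab => ?_⟩
  · rw [hin]; ring
  · rw [inner_lt_one_iff_real_of_norm_eq_one (hw a) (hw b)]
    intro h
    apply hab
    have := congrArg (fun z => ⟪(1 : ℝ) • e0 + (0 : ℝ) • e1, z⟫) h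
    simp only [hin, one_mul, zero_mul, add_zero] at this
    exact injective_rational_circle this

/-- A centre at distance `√(L² + s²)` from both `0` and `2Lw` is farther from `2Lw'`. -/
theorem norm_bisector_centre {E : Type*} [NormedAddCommGroup E] [InnerProductSpace ℝ E]
    {w v : E} (hw : ‖w‖ = 1) (hv : ‖v‖ = 1) (hwv : ⟪w, v⟫ = 0) (L s : ℝ) :
    ‖L • w + s • v‖ ^ 2 = L ^ 2 + s ^ 2 ∧ ∀ w' : E, ‖w'‖ = 1 →
      ‖(2 * L) • w' - (L • w + s • v)‖ ^ 2
        = L ^ 2 + s ^ 2 + 4 * L * (L * (1 - ⟪w', w⟫) - s * ⟪w', v⟫) := by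
  have h : ‖L • w + s • v‖ ^ 2 = L ^ 2 + s ^ 2 := by
    rw [norm_add_sq_real, norm_smul, norm_smul, real_inner_smul_left, real_inner_smul_right, hw,
      hv, hwv, mul_one, mul_one, Real.norm_eq_abs, Real.norm_eq_abs, sq_abs, sq_abs]
    ring
  refine ⟨h, fun w' hw' => ?_⟩
  rw [norm_sub_sq_real, h, norm_smul, hw', real_inner_smul_left, inner_add_right,
    real_inner_smul_right, real_inner_smul_right, mul_one, Real.norm_eq_abs, sq_abs]
  ring

theorem exists_orthonormal_coordinates {d : ℕ} (hd : 3 ≤ d) :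
    ∃ c : ℝ → ℝ → ℝ → EuclideanSpace ℝ (Fin d), ∀ p q t p' q' t',
      dist (c p q t) (c p' q' t') ^ 2 = (p - p') ^ 2 + (q - q') ^ 2 + (t - t') ^ 2 := by
  let e : Fin 3 → EuclideanSpace ℝ (Fin d) := fun i => EuclideanSpace.single (Fin.castLE hd i) 1
  refine ⟨fun p q t => p • e 0 + q • e 1 + t • e 2, fun p q t p' q' t' => ?_⟩
  have hin : ∀ i j, ⟪e i, e j⟫ = if i = j then 1 else 0 := by
    intro i j
    simp [e, EuclideanSpace.inner_single_left]
  rw [dist_eq_norm, show p • e 0 + q • e 1 + t • e 2 - (p' • e 0 + q' • e 1 + t' • e 2)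
    = (p - p') • e 0 + (q - q') • e 1 + (t - t') • e 2 by module, ← real_inner_self_eq_norm_sq]
  simp only [inner_add_left, inner_add_right, real_inner_smul_left, real_inner_smul_right, hin,
    Fin.reduceEq, if_true, if_false]
  ring

/-! ### Curves with a single vertex -/

/-- Points on two skew lines in a space of dimension at least three: each pair with one point on
either line is the set of nearest neighbours of some point. -/
theorem exists_finset_of_one_vertex {d : ℕ} (hd : 3 ≤ d) (A m : ℕ) :
    ∃ S : Finset (Curve d 1), S.card = A + m ∧
      ((A * m : ℕ) : ℕ∞) ≤ (voronoiRegions S).encard := by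
  obtain ⟨c, hc⟩ := exists_orthonormal_coordinates hd
  let pt : Fin A ⊕ Fin m → EuclideanSpace ℝ (Fin d) :=
    Sum.elim (fun a => c a 0 0) (fun b => c 0 b 1)
  have hpt : Function.Injective pt := by
    intro x y h
    have h0 : dist (pt x) (pt y) ^ 2 = 0 := by rw [h]; simp
    rcases x with a | b <;> rcases y with a' | b' <;>
      simp only [pt, Sum.elim_inl, Sum.elim_inr, hc] at h0
    · have : (a : ℝ) = a' := by nlinarith
      exact congrArg _ (Fin.ext (by exact_mod_cast this))
    · nlinarith [sq_nonneg ((a : ℝ) - 0), sq_nonneg ((0 : ℝ) - b')]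
    · nlinarith [sq_nonneg ((0 : ℝ) - a'), sq_nonneg ((b : ℝ) - 0)]
    · have : (b : ℝ) = b' := by nlinarith
      exact congrArg _ (Fin.ext (by exact_mod_cast this))
  let P : (Fin A ⊕ Fin m) ↪ Curve d 1 := ⟨fun x _ => pt x, fun x y h => hpt (congrFun h 0)⟩
  -- Solves `b² + z² = a² + (z - 1)²`, so the query is equidistant from its two chosen points.
  let z : Fin A × Fin m → ℝ := fun q => ((q.1 : ℝ) ^ 2 + 1 - (q.2 : ℝ) ^ 2) / 2
  let Q : Fin A × Fin m → Curve d 1 := fun q _ => c q.1 q.2 (z q)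
  let r : Fin A × Fin m → ℝ := fun q => √((q.2 : ℝ) ^ 2 + z q ^ 2)
  have hleft : ∀ q a, dist (P (Sum.inl a) 0) (Q q 0) ^ 2 = r q ^ 2 + ((a : ℝ) - q.1) ^ 2 := by
    intro q a
    change dist (c a 0 0) (c q.1 q.2 (z q)) ^ 2 = _
    rw [hc, Real.sq_sqrt (by positivity)]
    ring
  have hright : ∀ q b, dist (P (Sum.inr b) 0) (Q q 0) ^ 2 = r q ^ 2 + ((b : ℝ) - q.2) ^ 2 := by
    intro q b
    change dist (c 0 b 1) (c q.1 q.2 (z q)) ^ 2 = _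
    rw [hc, Real.sq_sqrt (by positivity)]
    simp only [z]
    ring
  have hr : ∀ q, 0 ≤ r q := fun q => Real.sqrt_nonneg _
  let N : Fin A × Fin m → Set (Fin A ⊕ Fin m) := fun q => {Sum.inl q.1, Sum.inr q.2}
  have hle : ∀ q x, r q ≤ dist (P x 0) (Q q 0) := by
    intro q x
    refine (sq_le_sq₀ (hr q) dist_nonneg).1 ?_
    rcases x with a | b
    · rw [hleft]; nlinarith
    · rw [hright]; nlinarith
  refine ⟨Finset.univ.map P, by simp, ?_⟩
  have := card_le_encard_voronoiRegions P Q r N ?_ (fun q => ⟨Sum.inl q.1, by simp [N]⟩)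
    (fun q x => (hle q x).trans (dist_zero_le_discreteFrechet _ _)) ?_
  · simpa using this
  · rintro ⟨a, b⟩ ⟨a', b'⟩ h
    have h1 : Sum.inl a ∈ N (a', b') := h ▸ (by simp [N])
    have h2 : Sum.inr b ∈ N (a', b') := h ▸ (by simp [N])
    simp only [N, Set.mem_insert_iff, Set.mem_singleton_iff, reduceCtorEq, or_false, false_or,
      Sum.inl.injEq, Sum.inr.injEq] at h1 h2
    rw [h1, h2]
  · intro q x
    rw [discreteFrechet_le_iff (R := r q + 1) (by linarith)
      (fun i j h => absurd (Fin.ext (by omega)) h), Fin.forall_fin_one,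
      ← sq_le_sq₀ dist_nonneg (hr q)]
    rcases x with a | b
    · rw [hleft]
      simp only [N, Set.mem_insert_iff, Set.mem_singleton_iff, reduceCtorEq, or_false,
        Sum.inl.injEq, add_le_iff_nonpos_right, Fin.ext_iff, sq_nonpos_iff, sub_eq_zero,
        Nat.cast_inj]
    · rw [hright]
      simp only [N, Set.mem_insert_iff, Set.mem_singleton_iff, reduceCtorEq, false_or,
        Sum.inr.injEq, add_le_iff_nonpos_right, Fin.ext_iff, sq_nonpos_iff, sub_eq_zero,
        Nat.cast_inj]

/-! ### Perturbations of a widely separated base curve -/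

/-- Curves and queries that are small perturbations of a base curve with widely separated vertices:
their discrete Fréchet distances are read off vertex by vertex. -/
theorem card_le_encard_voronoiRegions_of_offsets {d k : ℕ} (hd : 0 < d) {ι κ : Type*} [Fintype ι]
    [Fintype κ] {off : ι → Curve d (k + 1)} (hoff : Function.Injective off)
    {y : κ → Curve d (k + 1)} {r : κ → ℝ} {N : κ → Set ι} (hN : Function.Injective N)
    (hne : ∀ q, (N q).Nonempty) {L : ℝ} (hL : 0 < L) (hoffL : ∀ x i, ‖off x i‖ ≤ 2 * L)
    (hyL : ∀ q i, ‖y q i‖ ≤ 2 * L) (hrL : ∀ q, r q ≤ 2 * L)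
    (hle : ∀ q x, r q ≤ ‖off x 0 - y q 0‖)
    (hmem : ∀ q x, (∀ i, ‖off x i - y q i‖ ≤ r q) ↔ x ∈ N q) :
    ∃ S : Finset (Curve d (k + 1)), S.card = Fintype.card ι ∧
      (Fintype.card κ : ℕ∞) ≤ (voronoiRegions S).encard := by
  -- Two displacements of at most `2L` reduce a separation of `7L` to no less than `3L`, still above
  -- `r ≤ 2L`.
  let base : Curve d (k + 1) := fun i => EuclideanSpace.single ⟨0, hd⟩ (7 * L * i)
  have hbase : ∀ i j, i ≠ j → 7 * L ≤ ‖base i - base j‖ := by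
    intro i j hij
    have h1 : (1 : ℝ) ≤ |(i : ℝ) - j| := by
      have : (1 : ℤ) ≤ |(i : ℤ) - j| := Int.one_le_abs (by have := Fin.val_ne_of_ne hij; omega)
      exact_mod_cast this
    have h2 : base i - base j = EuclideanSpace.single ⟨0, hd⟩ (7 * L * ((i : ℝ) - j)) := by
      ext t
      by_cases ht : t = ⟨0, hd⟩ <;> simp [base, ht, mul_sub]
    rw [h2, PiLp.norm_single, norm_mul, Real.norm_of_nonneg (by positivity),
      Real.norm_eq_abs]
    nlinarith
  let P : ι ↪ Curve d (k + 1) := ⟨fun x => base + off x, fun x x' h => hoff (add_left_cancel h)⟩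
  let Q : κ → Curve d (k + 1) := fun q => base + y q
  have hdist : ∀ q x i, dist (P x i) (Q q i) = ‖off x i - y q i‖ := by
    intro q x i
    rw [dist_eq_norm]
    exact congrArg norm (add_sub_add_left_eq_sub _ _ _)
  refine ⟨Finset.univ.map P, by simp, card_le_encard_voronoiRegions P Q r N hN hne ?_ ?_⟩
  · intro q x
    exact ((hle q x).trans_eq (hdist q x 0).symm).trans (dist_zero_le_discreteFrechet _ _)
  · intro q x
    rw [discreteFrechet_le_iff (R := 3 * L) (by linarith [hrL q]), ← hmem]
    · simp only [hdist]
    · intro i j hij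
      have h1 : base i - base j = (P x i - Q q j) - (off x i - y q j) := by
        change _ = (base i + off x i - (base j + y q j)) - _
        abel
      have h2 := hbase i j hij
      rw [h1] at h2
      rw [dist_eq_norm]
      linarith [norm_sub_le (P x i - Q q j) (off x i - y q j), norm_sub_le (off x i) (y q j),
        hoffL x i, hyL q j]

/-- Only finitely many pairs matter. Multiplied by `L`, the inequality says that `c a b * L`
outgrows `√(K * L)`. -/
theorem exists_large_scale {A : ℕ} {c : Fin A → Fin A → ℝ} (hc : ∀ a b, a ≠ b → 0 < c a b)
    (B K : ℝ) : ∃ L, B ≤ L ∧ ∀ a b, a ≠ b → K < c a b ^ 2 * L := by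
  have h : ∀ᶠ L : ℝ in Filter.atTop, ∀ a b, a ≠ b → K < c a b ^ 2 * L := by
    simp only [Filter.eventually_all]
    intro a b hab
    exact (Filter.tendsto_id.const_mul_atTop (pow_pos (hc a b hab) 2)).eventually_gt_atTop K
  exact ((Filter.eventually_ge_atTop B).and h).exists

/-! ### Chains, sites and queries for at least two vertices -/

/-- The indices of the chains: one for each coordinate of each vertex but the first, and an
additional one. -/
abbrev Chain (d k : ℕ) : Type := Option (Fin (k + 1) × Fin d)

/-- The vertex at which the curves of a chain leave the base curve. -/
def Chain.vertex {d k : ℕ} : Chain d k → Fin (k + 2)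
  | none => 1
  | some p => p.1.succ

theorem Chain.vertex_ne_zero {d k : ℕ} (g : Chain d k) : g.vertex ≠ 0 := by
  rcases g with _ | p
  · exact Fin.succ_ne_zero (0 : Fin (k + 1))
  · exact Fin.succ_ne_zero _

/-- The direction in which the curves of a chain leave the base curve. -/
noncomputable def Chain.direction {d k : ℕ} (hd : 0 < d) : Chain d k → EuclideanSpace ℝ (Fin d)
  | none => -EuclideanSpace.single ⟨0, hd⟩ 1
  | some p => EuclideanSpace.single p.2 1

theorem Chain.norm_direction {d k : ℕ} (hd : 0 < d) (g : Chain d k) : ‖g.direction hd‖ = 1 := by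
  rcases g with _ | p <;> simp [Chain.direction]

/-- The extra chain shares its vertex with the chain in the opposite direction; positivity of the
lengths keeps them apart. -/
theorem Chain.eq_of_smul_direction_eq {d k : ℕ} (hd : 0 < d) {g g' : Chain d k}
    (hv : g.vertex = g'.vertex) {t t' : ℝ} (ht : 0 < t) (ht' : 0 < t')
    (h : t • g.direction hd = t' • g'.direction hd) : t = t' ∧ g = g' := by
  have h1 : t = t' := by
    have := congrArg norm h
    rwa [norm_smul, norm_smul, g.norm_direction, g'.norm_direction, mul_one, mul_one,
      Real.norm_of_nonneg ht.le, Real.norm_of_nonneg ht'.le] at this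
  subst h1
  refine ⟨rfl, ?_⟩
  have h2 : g.direction hd = g'.direction hd := smul_right_injective _ ht.ne' h
  rcases g with _ | ⟨i, e⟩ <;> rcases g' with _ | ⟨i', e'⟩
  · rfl
  · have := congrArg (fun z => z ⟨0, hd⟩) h2
    by_cases he : (⟨0, hd⟩ : Fin d) = e' <;> simp [Chain.direction, he] at this
    norm_num at this
  · have := congrArg (fun z => z ⟨0, hd⟩) h2
    by_cases he : (⟨0, hd⟩ : Fin d) = e <;> simp [Chain.direction, he] at this
    norm_num at this
  · have hi : i = i' := Fin.succ_injective _ hv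
    have := congrArg (fun z => z e) h2
    by_cases he : e = e'
    · rw [hi, he]
    · simp [Chain.direction, he] at this

/-- The displacements from the base curve: the first vertex moves to a point of a circle of radius
`2L`, or a later vertex moves along a chain. -/
noncomputable def offset {d k A m : ℕ} (hd : 0 < d) (L : ℝ) (w : ℕ → EuclideanSpace ℝ (Fin d)) :
    Fin A ⊕ Fin m × Chain d k → Curve d (k + 2)
  | .inl a => Pi.single 0 ((2 * L) • w a)
  | .inr p => Pi.single p.2.vertex ((L + (p.1 : ℕ)) • p.2.direction hd)

theorem offset_injective {d k A m : ℕ} (hd : 0 < d) {L : ℝ} (hL : 0 < L)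
    {w : ℕ → EuclideanSpace ℝ (Fin d)} (hw : Function.Injective w) (hw1 : ∀ a, ‖w a‖ = 1) :
    Function.Injective (offset hd L w : Fin A ⊕ Fin m × Chain d k → Curve d (k + 2)) := by
  have hpos : ∀ j : Fin m, 0 < L + (j : ℝ) := fun j => by positivity
  have hw0 : ∀ a, w a ≠ 0 := fun a h => by simpa [h] using hw1 a
  have hdir : ∀ (j : Fin m) (g : Chain d k), (L + (j : ℝ)) • g.direction hd ≠ 0 := by
    intro j g h
    have := g.norm_direction hd
    rcases smul_eq_zero.1 h with h | h
    · exact (hpos j).ne' h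
    · simp [h] at this
  rintro (a | ⟨j, g⟩) (b | ⟨j', g'⟩) h <;> simp only [offset] at h
  · have := hw (smul_right_injective _ (by positivity : (2 * L) ≠ 0) (Pi.single_injective (M := fun _ => EuclideanSpace ℝ (Fin d)) _ h))
    exact congrArg _ (Fin.ext this)
  · have := congrFun h 0
    rw [Pi.single_eq_same, Pi.single_eq_of_ne g'.vertex_ne_zero.symm] at this
    exact absurd this (smul_ne_zero (by positivity) (hw0 _))
  · have := congrFun h 0
    rw [Pi.single_eq_same, Pi.single_eq_of_ne g.vertex_ne_zero.symm] at this
    exact absurd this.symm (smul_ne_zero (by positivity) (hw0 _))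
  · have hv : g.vertex = g'.vertex := by
      by_contra hv
      have := congrFun h g.vertex
      rw [Pi.single_eq_same, Pi.single_eq_of_ne hv] at this
      exact hdir _ _ this
    rw [hv] at h
    obtain ⟨h1, h2⟩ := Chain.eq_of_smul_direction_eq hd hv (hpos j) (hpos j')
      (Pi.single_injective (M := fun _ => EuclideanSpace ℝ (Fin d)) _ h)
    have h3 : (j : ℝ) = j' := by linarith
    rw [h2, Fin.ext (by exact_mod_cast h3 : (j : ℕ) = j')]

/-- The real threshold for a chain of which exactly the members up to `f g` are to be cut off. -/
noncomputable def threshold {d k m : ℕ} (f : Chain d k → Fin m) (g : Chain d k) : ℝ :=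
  (f g : ℝ) + 1 / 2

/-- The excess of the radius over its base value. -/
noncomputable def excess {d k m : ℕ} (hd : 0 < d) (f : Chain d k → Fin m) : ℝ :=
  (threshold f (some (0, ⟨0, hd⟩)) + threshold f none) / 2

theorem threshold_bounds {d k m : ℕ} (f : Chain d k → Fin m) (g : Chain d k) :
    1 / 2 ≤ threshold f g ∧ threshold f g ≤ m - 1 / 2 := by
  have h1 : ((f g : ℕ) : ℝ) + 1 ≤ m := by exact_mod_cast (f g).isLt
  have h2 : (0 : ℝ) ≤ (f g : ℕ) := by positivity
  unfold threshold
  constructor <;> linarith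

theorem excess_bounds {d k m : ℕ} (hd : 0 < d) (f : Chain d k → Fin m) :
    1 / 2 ≤ excess hd f ∧ excess hd f ≤ m - 1 / 2 := by
  have h1 := threshold_bounds f (some (0, ⟨0, hd⟩))
  have h2 := threshold_bounds f none
  unfold excess
  constructor <;> linarith

/-- The displacement of a later vertex of a query. -/
noncomputable def centre {d k m : ℕ} (hd : 0 < d) (f : Chain d k → Fin m) (i : Fin (k + 1)) :
    EuclideanSpace ℝ (Fin d) :=
  WithLp.toLp 2 fun e => threshold f (some (i, e)) - excess hd f

theorem norm_centre_sq_le {d k m : ℕ} (hd : 0 < d) (f : Chain d k → Fin m) (i : Fin (k + 1)) :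
    ‖centre hd f i‖ ^ 2 ≤ d * (m : ℝ) ^ 2 := by
  rw [EuclideanSpace.norm_sq_eq]
  refine (Finset.sum_le_sum (g := fun _ => (m : ℝ) ^ 2) fun e _ => ?_).trans (by simp)
  have h1 := threshold_bounds f (some (i, e))
  have h2 := excess_bounds hd f
  rw [Real.norm_eq_abs, sq_abs]
  refine sq_le_sq' ?_ ?_ <;> simp only [centre] <;> linarith

/-- The displacements of the vertices of a query. -/
noncomputable def queryOffset {d k A m : ℕ} (hd : 0 < d) (L : ℝ)
    (w v : ℕ → EuclideanSpace ℝ (Fin d)) (q : Fin A × (Chain d k → Fin m)) : Curve d (k + 2) :=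
  Fin.cons (L • w q.1 + √((L + excess hd q.2) ^ 2 - L ^ 2) • v q.1) (centre hd q.2)

/-- The opposite directions at vertex `1` demand `c = u - δ` and `-c = u' - δ`, which forces the
excess `δ` to be the mean of the two thresholds. -/
theorem inner_direction_queryOffset {d k A m : ℕ} (hd : 0 < d) (L : ℝ)
    (w v : ℕ → EuclideanSpace ℝ (Fin d)) (q : Fin A × (Chain d k → Fin m)) (g : Chain d k) :
    ⟪g.direction hd, queryOffset hd L w v q g.vertex⟫ = threshold q.2 g - excess hd q.2 := by
  rcases g with _ | ⟨i, e⟩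
  · have : queryOffset hd L w v q (Chain.vertex (none : Chain d k)) = centre hd q.2 0 := rfl
    rw [this]
    simp only [Chain.direction, inner_neg_left, EuclideanSpace.inner_single_left, map_one, one_mul,
      centre, excess]
    ring
  · have : queryOffset hd L w v q (Chain.vertex (some (i, e))) = centre hd q.2 i := rfl
    rw [this]
    simp only [Chain.direction, EuclideanSpace.inner_single_left, map_one, one_mul, centre]

/-- The set of indices of the nearest neighbours of a query. -/
def neighborIndices {d k A m : ℕ} (q : Fin A × (Chain d k → Fin m)) :
    Set (Fin A ⊕ Fin m × Chain d k) :=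
  {x | Sum.elim (fun a => a = q.1) (fun p => p.1 ≤ q.2 p.2) x}

theorem neighborIndices_injective {d k A m : ℕ} :
    Function.Injective (neighborIndices (d := d) (k := k) (A := A) (m := m)) := by
  rintro ⟨a, f⟩ ⟨a', f'⟩ h
  have h1 : Sum.inl a ∈ neighborIndices (a', f') := h ▸ (rfl : Sum.inl a ∈ neighborIndices (a, f))
  refine Prod.ext h1 (funext fun g => le_antisymm ?_ ?_)
  · have : Sum.inr (f g, g) ∈ neighborIndices (a', f') :=
      h ▸ (le_refl (f g) : Sum.inr (f g, g) ∈ neighborIndices (a, f))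
    exact this
  · have : Sum.inr (f' g, g) ∈ neighborIndices (a, f) :=
      h ▸ (le_refl (f' g) : Sum.inr (f' g, g) ∈ neighborIndices (a', f'))
    exact this

/-! ### The lower bound for at least two vertices, and the theorem -/

theorem exists_finset_of_two_le_vertices {d : ℕ} (hd : 2 ≤ d) (k A m : ℕ) :
    ∃ S : Finset (Curve d (k + 2)), S.card = A + m * ((k + 1) * d + 1) ∧
      ((A * m ^ ((k + 1) * d + 1) : ℕ) : ℕ∞) ≤ (voronoiRegions S).encard := by
  have hd0 : 0 < d := by omega
  obtain ⟨w, v, hw, hv, hwv, hww⟩ := exists_unit_vectors hd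
  have hwinj : Function.Injective w := by
    intro a b h
    by_contra hab
    have := hww a b hab
    rw [h, real_inner_self_eq_norm_sq, hw] at this
    norm_num at this
  -- The first bound lets `L` dominate `m`, `1` and `m² + ‖y‖²` at later vertices; `3 * m` enters
  -- because `s² = 2Lδ + δ² ≤ 3mL` when `δ ≤ m ≤ L`.
  obtain ⟨L, hLB, hLw⟩ := exists_large_scale (A := A) (c := fun a b => 1 - ⟪w a, w b⟫)
    (fun a b hab => sub_pos.2 (hww a b (Fin.val_ne_of_ne hab)))
    ((m : ℝ) ^ 2 + d * (m : ℝ) ^ 2 + m + 1) (3 * m)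
  have hm0 : (0 : ℝ) ≤ m := by positivity
  have hdm : 0 ≤ d * (m : ℝ) ^ 2 := by positivity
  have hm2 : 0 ≤ (m : ℝ) ^ 2 := by positivity
  have hL1 : 1 ≤ L := by linarith
  have hL0 : 0 < L := by linarith
  have hLm : m ≤ L := by linarith
  let off : Fin A ⊕ Fin m × Chain d k → Curve d (k + 2) := offset hd0 L w
  let y : Fin A × (Chain d k → Fin m) → Curve d (k + 2) := queryOffset hd0 L w v
  let r : Fin A × (Chain d k → Fin m) → ℝ := fun q => L + excess hd0 q.2
  -- The height over the midpoint `L • w` that gives `L² + s² = r²`.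
  let s : Fin A × (Chain d k → Fin m) → ℝ := fun q => √((L + excess hd0 q.2) ^ 2 - L ^ 2)
  have hδ : ∀ q : Fin A × (Chain d k → Fin m), 0 ≤ excess hd0 q.2 ∧ excess hd0 q.2 ≤ m :=
    fun q => by have := excess_bounds hd0 q.2; constructor <;> linarith
  have hr0 : ∀ q, 0 ≤ r q := fun q => by simp only [r]; linarith [(hδ q).1]
  have hs : ∀ q, s q ^ 2 = r q ^ 2 - L ^ 2 := fun q =>
    Real.sq_sqrt (by nlinarith [(hδ q).1])
  have hrL : ∀ q, r q ≤ 2 * L := fun q => by simp only [r]; linarith [(hδ q).2]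
  have hy0 : ∀ q, ‖y q 0‖ = r q := by
    intro q
    refine (sq_eq_sq₀ (norm_nonneg _) (hr0 q)).1 ?_
    have := (norm_bisector_centre (hw q.1) (hv q.1) (hwv q.1) L (s q)).1
    rw [hs] at this
    exact this.trans (by ring)
  have hys : ∀ q (i : Fin (k + 2)), i ≠ 0 → ‖y q i‖ ^ 2 ≤ d * (m : ℝ) ^ 2 := by
    intro q i hi
    obtain ⟨i, rfl⟩ := Fin.exists_succ_eq.2 hi
    exact norm_centre_sq_le hd0 q.2 i
  have hysL : ∀ q (i : Fin (k + 2)), i ≠ 0 → ‖y q i‖ ≤ L := fun q i hi =>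
    (sq_le_sq₀ (norm_nonneg _) hL0.le).1 (by nlinarith [hys q i hi])
  have hysr : ∀ q (i : Fin (k + 2)), i ≠ 0 → ‖y q i‖ ≤ r q := fun q i hi =>
    (hysL q i hi).trans (by simp only [r]; linarith [(hδ q).1])
  have hinl0 : ∀ q (a : Fin A), ‖off (Sum.inl a) 0 - y q 0‖ ^ 2
      = r q ^ 2 + 4 * L * (L * (1 - ⟪w a, w q.1⟫) - s q * ⟪w a, v q.1⟫) := by
    intro q a
    have := (norm_bisector_centre (hw q.1) (hv q.1) (hwv q.1) L (s q)).2 (w a) (hw a)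
    rw [hs] at this
    refine Eq.trans ?_ (this.trans (by ring))
    congr 2
  have hinl : ∀ q (a : Fin A), a ≠ q.1 → r q < ‖off (Sum.inl a) 0 - y q 0‖ := by
    intro q a ha
    refine (sq_lt_sq₀ (hr0 q) (norm_nonneg _)).1 ?_
    rw [hinl0]
    have h1 : s q < L * (1 - ⟪w a, w q.1⟫) := by
      have hpos := sub_pos.2 (hww a q.1 (Fin.val_ne_of_ne ha))
      refine (sq_lt_sq₀ (Real.sqrt_nonneg _) (by positivity)).1 ?_
      have h2 := mul_lt_mul_of_pos_right (hLw a q.1 ha) hL0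
      have h3 : s q ^ 2 ≤ 3 * m * L := by
        rw [hs]
        simp only [r]
        nlinarith [mul_nonneg (sub_nonneg.2 (hδ q).2) hL0.le, mul_nonneg (hδ q).1
          (sub_nonneg.2 ((hδ q).2.trans hLm))]
      exact (h3.trans_lt h2).trans_eq (by ring)
    have h2 : ⟪w a, v q.1⟫ ≤ 1 := by
      have := real_inner_le_norm (w a) (v q.1)
      rwa [hw, hv, mul_one] at this
    have h3 : s q * ⟪w a, v q.1⟫ ≤ s q := mul_le_of_le_one_right (Real.sqrt_nonneg _) h2
    have : 0 < 4 * L * (L * (1 - ⟪w a, w q.1⟫) - s q * ⟪w a, v q.1⟫) :=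
      mul_pos (by positivity) (by linarith)
    linarith
  have hinl_eq : ∀ q : Fin A × (Chain d k → Fin m), ‖off (Sum.inl q.1) 0 - y q 0‖ = r q := by
    intro q
    refine (sq_eq_sq₀ (norm_nonneg _) (hr0 q)).1 ?_
    rw [hinl0, real_inner_self_eq_norm_sq, hw, hwv]
    ring
  have hinr0 : ∀ q p, ‖off (Sum.inr p) 0 - y q 0‖ = r q := by
    intro q p
    rw [← hy0, ← norm_neg (y q 0), ← zero_sub]
    congr 2
    exact Pi.single_eq_of_ne p.2.vertex_ne_zero.symm _
  have hinr : ∀ q p, ‖off (Sum.inr p) p.2.vertex - y q p.2.vertex‖ ≤ r q ↔ p.1 ≤ q.2 p.2 := by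
    rintro q ⟨j, g⟩
    -- Chain positions are integers and thresholds half-integers, hence the gap of `1/2`.
    have h1 := norm_smul_sub_le_iff (g.norm_direction hd0) (L := L) (m := m) (t := (j : ℝ))
      (by linarith [hys q g.vertex g.vertex_ne_zero]) (hδ q).1
      (inner_direction_queryOffset hd0 L w v q g)
      (by linarith [(threshold_bounds q.2 g).2, (Nat.cast_nonneg (j : ℕ) : (0 : ℝ) ≤ (j : ℕ))])
      (fun h => by
        unfold threshold at *
        have h2 : (j : ℕ) < (q.2 g : ℕ) + 1 := by
          have : ((j : ℕ) : ℝ) < ((q.2 g : ℕ) : ℝ) + 1 := by linarith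
          exact_mod_cast this
        have h3 : ((j : ℕ) : ℝ) ≤ (q.2 g : ℕ) := by exact_mod_cast Nat.lt_succ_iff.1 h2
        linarith)
      (fun h => by
        unfold threshold at h
        have h2 : 2 * ((j : ℕ) : ℝ) = 2 * ((q.2 g : ℕ) : ℝ) + 1 := by linarith
        have h3 : 2 * (j : ℕ) = 2 * (q.2 g : ℕ) + 1 := by exact_mod_cast h2
        omega)
    have h4 : off (Sum.inr (j, g)) g.vertex = (L + ((j : ℕ) : ℝ)) • g.direction hd0 :=
      Pi.single_eq_same _ _
    rw [h4]
    refine h1.trans ?_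
    unfold threshold
    rw [Fin.le_def]
    constructor
    · intro h
      have : ((j : ℕ) : ℝ) < ((q.2 g : ℕ) : ℝ) + 1 := by linarith
      exact Nat.lt_succ_iff.1 (by exact_mod_cast this)
    · intro h
      have : ((j : ℕ) : ℝ) ≤ (q.2 g : ℕ) := by exact_mod_cast h
      linarith
  have hoff0 : ∀ q x (i : Fin (k + 2)), i ≠ 0 → off x i = 0 → ‖off x i - y q i‖ ≤ r q := by
    intro q x i hi h
    rw [h, zero_sub, norm_neg]
    exact hysr q i hi
  have hoffL : ∀ x i, ‖off x i‖ ≤ 2 * L := by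
    rintro (a | p) i
    · by_cases hi : i = 0
      · subst hi
        simp [off, offset, norm_smul, hw, abs_of_pos hL0]
      · simp [off, offset, Pi.single_eq_of_ne hi, hL0.le]
    · by_cases hi : i = p.2.vertex
      · subst hi
        have : ((p.1 : ℕ) : ℝ) ≤ m := by exact_mod_cast p.1.isLt.le
        simp only [off, offset, Pi.single_eq_same, norm_smul, Chain.norm_direction, mul_one]
        rw [Real.norm_of_nonneg (by positivity)]
        linarith
      · simp [off, offset, Pi.single_eq_of_ne hi, hL0.le]
  have hyL : ∀ q i, ‖y q i‖ ≤ 2 * L := by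
    intro q i
    by_cases hi : i = 0
    · rw [hi, hy0]; exact hrL q
    · linarith [hysL q i hi]
  have hle : ∀ q x, r q ≤ ‖off x 0 - y q 0‖ := by
    rintro q (a | p)
    · by_cases ha : a = q.1
      · rw [ha, hinl_eq]
      · exact (hinl q a ha).le
    · exact (hinr0 q p).ge
  have hmem : ∀ q x, (∀ i, ‖off x i - y q i‖ ≤ r q) ↔ x ∈ neighborIndices q := by
    rintro q (a | p)
    · constructor
      · intro h
        by_contra ha
        exact absurd (h 0) (not_le.2 (hinl q a ha))
      · intro (ha : a = q.1) i
        by_cases hi : i = 0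
        · rw [hi, ha, hinl_eq]
        · exact hoff0 q _ i hi (Pi.single_eq_of_ne hi _)
    · refine ⟨fun h => (hinr q p).1 (h _), fun h i => ?_⟩
      by_cases hi : i = 0
      · rw [hi, hinr0]
      · by_cases hi' : i = p.2.vertex
        · rw [hi']
          exact (hinr q p).2 h
        · exact hoff0 q _ i hi (Pi.single_eq_of_ne hi' _)
  obtain ⟨S, hS, hSV⟩ := card_le_encard_voronoiRegions_of_offsets hd0
    (offset_injective hd0 hL0 hwinj hw) neighborIndices_injective
    (fun q => ⟨Sum.inl q.1, rfl⟩) hL0 hoffL hyL hrL hle hmem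
  refine ⟨S, ?_, ?_⟩
  · rw [hS]; simp
  · simpa using hSV

end FrechetVoronoi

theorem lemma3 (n k d : ℕ) (hd : 2 ≤ d) (hk : 1 ≤ k) (hdk : ¬(d = 2 ∧ k = 1)) :
    ∃ S : Finset (FrechetVoronoi.Curve d k), S.card = n ∧
      (((n / (d * (k - 1) + 2)) ^ (d * (k - 1) + 2) : ℕ) : ℕ∞) ≤
        (FrechetVoronoi.voronoiRegions S).encard := by
  set m := n / (d * (k - 1) + 2) with hm
  have hmn : m * (d * (k - 1) + 2) ≤ n := Nat.div_mul_le_self _ _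
  -- The `A` surplus sites join the circle, or the first line if `k = 1`, which can only raise the
  -- count.
  obtain ⟨A, hA⟩ := Nat.exists_eq_add_of_le hmn
  rcases k with _ | _ | k
  · omega
  · obtain ⟨S, hS, hSV⟩ := FrechetVoronoi.exists_finset_of_one_vertex (d := d) (by omega) (m + A) m
    refine ⟨S, by rw [hS, hA]; simp; ring, le_trans ?_ hSV⟩
    have : m ^ (d * (0 + 1 - 1) + 2) ≤ (m + A) * m := by
      simp only [Nat.zero_add, Nat.sub_self, Nat.mul_zero]
      nlinarith
    exact_mod_cast this
  · obtain ⟨S, hS, hSV⟩ := FrechetVoronoi.exists_finset_of_two_le_vertices hd k (m + A) m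
    simp only [Nat.add_sub_cancel] at *
    refine ⟨S, by rw [hS, hA]; ring, le_trans ?_ hSV⟩
    have : m ^ (d * (k + 1) + 2) ≤ (m + A) * m ^ ((k + 1) * d + 1) := by
      rw [mul_comm d, pow_succ' m ((k + 1) * d + 1)]
      exact Nat.mul_le_mul_right _ (Nat.le_add_right _ _)
    exact_mod_cast this
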